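/- Let $G$ be a complex connected reductive group with maximal torus $T$, Borel subgroup $B\supset T$, finite reduced crystallographic root system $\Delta$, positive roots $\Delta_+$ and Weyl group $W$. Write $r_\beta\in W$ for the reflection in $\beta\in\Delta$, $l$ for the length function on $W$ with respect to the simple reflections, and $>$ and $\gtrdot$ for the strong Bruhat order on $W$ and its covering relation. Let $R$ be an integral domain of characteristic zero, let the roots lie in the free $R$-module $M$ of finite rank (the weights of $T$ with coefficients in $R$; for example $R=\mathbb{Z}$ and $M$ the character lattice of $T$), and let $H_T^*(\mathrm{pt})=\mathrm{Sym}_R(M)$, the elements of $M$ having polynomial degree one (cohomological degree two). For $\alpha,\beta\in\Delta$ put $\langle\alpha,\beta\rangle=(\alpha-r_\beta\alpha)/\beta\in\mathbb{Z}$. A \emph{class} is a list $p=(p|_v)_{v\in W}$ of elements of $H_T^*(\mathrm{pt})$ such that $p|_v-p|_{r_\beta v}$ is a multiple of $\beta$ for all $v\in W$ and $\beta\in\Delta$. The classes, with pointwise operations, form an $H_T^*(\mathrm{pt})$-algebra, the combinatorial (GKM) model of $H_T^*(G/B)$. The noncomplex right action of $W$ on $G/B\cong K/T$ ($K$ a maximal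 compact subgroup) corresponds to $(p\cdot w)|_v=p|_{vw}$. For each $w\in W$ there is exactly one class $S_w$, the equivariant Schubert class, such that every $S_w|_v$ is homogeneous of polynomial degree $l(w)$, $S_w|_v=0$ whenever $l(v)\le l(w)$ and $v\ne w$, and $S_w|_w=\prod_{\beta\in\Delta_+,\ r_\beta w<w}\beta$. Let $w\in W$ and let $\alpha$ be a simple root. If $wr_\alpha>w$, then $S_w\cdot r_\alpha=S_w$. Otherwise $$S_w\cdot r_\alpha=S_w-(w\cdot\alpha)\,S_{wr_\alpha}-\sum_{\substack{\beta\in\Delta_+\\ w'=wr_\alpha r_\beta\,\gtrdot\, wr_\alpha}}\langle\alpha,\beta\rangle\,S_{w'}.$$ -/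

import Mathlib

open RootPairing

noncomputable section

namespace Schubert

variable {ι R M N : Type*} [CommRing R] [AddCommGroup M] [Module R M]
  [AddCommGroup N] [Module R N]

section Weyl

variable (P : RootPairing ι R M N)

/-- The reflection `r_β` as an element of the Weyl group. -/
abbrev refl (β : ι) : P.weylGroup := weylGroup.ofIdx P β

/-- The coefficient ring `H_T^*(pt)`: the symmetric algebra of the weight module. A weight
is placed in cohomological degree two, that is, in polynomial degree one. -/
abbrev CoeffRing (_P : RootPairing ι R M N) : Type _ := SymmetricAlgebra R M

/-- A weight, regarded as an element of the coefficient ring. -/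
abbrev wt (x : M) : CoeffRing P := SymmetricAlgebra.ι R M x

/-- The homogeneous polynomials of degree `n` (cohomological degree `2 * n`). -/
def homogeneousPart (n : ℕ) : Submodule R (CoeffRing P) :=
  LinearMap.range (SymmetricAlgebra.ι R M) ^ n

/-- The GKM model of `H_T^*(G/B)`: lists `(p|_v)` of polynomials, indexed by the Weyl group,
such that `p|_v - p|_{r_β v}` is a multiple of `β` for every `v` and every root `β`. The ring
structure is pointwise, and the coefficient ring is embedded as the constant lists. -/
def ClassRing : Subalgebra (CoeffRing P) (P.weylGroup → CoeffRing P) where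
  carrier := {p | ∀ (v : P.weylGroup) (β : ι), wt P (P.root β) ∣ p v - p (refl P β * v)}
  mul_mem' := by
    intro p q hp hq v β
    have h : (p * q) v - (p * q) (refl P β * v) =
        (p v - p (refl P β * v)) * q v + p (refl P β * v) * (q v - q (refl P β * v)) := by
      simp only [Pi.mul_apply]; ring
    rw [h]
    exact dvd_add ((hp v β).mul_right _) ((hq v β).mul_left _)
  add_mem' := by
    intro p q hp hq v β
    have h : (p + q) v - (p + q) (refl P β * v) =
        (p v - p (refl P β * v)) + (q v - q (refl P β * v)) := by
      simp only [Pi.add_apply]; ring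
    rw [h]
    exact dvd_add (hp v β) (hq v β)
  algebraMap_mem' := by
    intro c v β
    simp [Pi.algebraMap_apply]

/-- The noncomplex action of the Weyl group on classes, `(p · w)|_v = p|_{v w}`; each `w` acts
by an algebra endomorphism over the coefficient ring. -/
def rightAct (w : P.weylGroup) : ClassRing P →ₐ[CoeffRing P] ClassRing P where
  toFun p := ⟨fun v => p.1 (v * w), fun v β => by
    simpa only [mul_assoc] using p.2 (v * w) β⟩
  map_one' := rfl
  map_mul' _ _ := rfl
  map_zero' := rfl
  map_add' _ _ := rfl
  commutes' _ := rfl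

end Weyl

variable {P : RootPairing ι R M N} (b : P.Base)

/-- The length of a Weyl group element: the least length of a word in the simple reflections
that represents it. -/
def length (w : P.weylGroup) : ℕ :=
  sInf {n | ∃ l : List b.support, l.length = n ∧ (l.map fun i => refl P i).prod = w}

/-- The strict (strong) Bruhat order: `u < v` if `v` is reached from `u` by one or more right
multiplications by reflections, each of which increases the length. -/
def BruhatLT : P.weylGroup → P.weylGroup → Prop :=
  Relation.TransGen fun u v => ∃ β : ι, v = u * refl P β ∧ length b u < length b v

/-- `BruhatCovers b v u` says that `v` covers `u` in the Bruhat order. -/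
def BruhatCovers (v u : P.weylGroup) : Prop :=
  BruhatLT b u v ∧ ∀ x, ¬ (BruhatLT b u x ∧ BruhatLT b x v)

variable [CharZero R] [Fintype ι]

open scoped Classical in
/-- The positive roots `β` with `r_β w < w`. -/
def inversions (w : P.weylGroup) : Finset ι :=
  Finset.univ.filter fun β => b.IsPos β ∧ BruhatLT b (refl P β * w) w

open scoped Classical in
/-- The positive roots `β` such that `u r_β` covers `u`. -/
def coverRoots (u : P.weylGroup) : Finset ι :=
  Finset.univ.filter fun β => b.IsPos β ∧ BruhatCovers b (u * refl P β) u

/-- The conditions characterizing the equivariant Schubert class `S_w`. -/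
structure IsSchubertClass (w : P.weylGroup) (p : ClassRing P) : Prop where
  /-- The class is homogeneous of polynomial degree `l(w)`. -/
  homogeneous : ∀ v, p.1 v ∈ homogeneousPart P (length b w)
  /-- It vanishes at all other elements that are not longer than `w`. -/
  vanishing : ∀ v, length b v ≤ length b w → v ≠ w → p.1 v = 0
  /-- Its value at `w` is the product of the positive roots `β` with `r_β w < w`. -/
  value : p.1 w = ∏ β ∈ inversions b w, wt P (P.root β)

/-- The equivariant Schubert class `S_w`: the class with the characterizing properties. -/
def schubertClass (w : P.weylGroup) : ClassRing P :=
  Classical.epsilon (IsSchubertClass b w)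

end Schubert

end

/-! Everything rests on a degree argument. If a homogeneous class of degree `d` vanishes at every
`r_β v` shorter than `v`, then the GKM condition makes `p|_v` divisible by all inversions of `v`.
These are `l(v)` pairwise coprime linear forms, so `p|_v = 0` once `l(v) > d`. Hence a class of
degree `d` is determined by its values at elements of length at most `d`
(`eq_zero_of_forall_length_le`), which gives uniqueness of Schubert classes.

Existence comes from divided differences (`exists_dividedDifference`): start from the class
supported at the longest element and descend. If `wα` is negative, the divided difference of `S_w`
is `S_{w r_α}`, so `S_w · r_α` equals `S_w` plus `(v·α) S_{w r_α}|_v` at each `v`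
(`schubert_sub_right`). If `wα` is positive, the divided difference vanishes by degree. The factor
`v·α` is removed by the equivariant Chevalley formula `root_mul_schubert`, itself checked only at
elements of length at most `l(u) + 1`, where it reduces to `schubert_value_cover`.

The degree argument needs the roots to be primes, distinct up to sign. This can fail in `Sym_R(M)`:
a root may be divisible in `M`, and `R` need not be factorial. `IsRootForms` isolates what is needed
and is verified twice: for integral polynomials in the simple roots, where the classes are built and
the formulas proved before being specialized, and for polynomials over the fraction field of `R`,
which contain `Sym_R(M)` and yield uniqueness there. -/

noncomputable section

namespace Schubert

set_option linter.unusedSectionVars false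

/-! ### The Weyl group action on roots and reflections -/

section WeylAction

variable {ι R M N : Type*} [CommRing R] [AddCommGroup M] [Module R M]
  [AddCommGroup N] [Module R N] (P : RootPairing ι R M N)

/-- The action of the Weyl group on the index set of the roots. -/
def act (w : P.weylGroup) (i : ι) : ι := P.weylGroupToPerm w i

/-- The index of the negative of a root. -/
abbrev negIdx (i : ι) : ι := P.reflectionPerm i i

@[simp] lemma act_one (i : ι) : act P 1 i = i := by simp [act]

lemma act_mul (u v : P.weylGroup) (i : ι) : act P (u * v) i = act P u (act P v i) := by
  simp only [act, map_mul, Equiv.Perm.mul_apply]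

@[simp] lemma act_inv_act (u : P.weylGroup) (i : ι) : act P u⁻¹ (act P u i) = i := by
  rw [← act_mul, inv_mul_cancel, act_one]

@[simp] lemma act_act_inv (u : P.weylGroup) (i : ι) : act P u (act P u⁻¹ i) = i := by
  rw [← act_mul, mul_inv_cancel, act_one]

lemma act_refl (i j : ι) : act P (refl P i) j = P.reflectionPerm i j := rfl

lemma root_act (w : P.weylGroup) (i : ι) : P.root (act P w i) = w • P.root i :=
  (P.weylGroup_apply_root w i).symm

lemma root_negIdx (i : ι) : P.root (negIdx P i) = -P.root i := by simp [negIdx]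

lemma act_negIdx (w : P.weylGroup) (i : ι) : act P w (negIdx P i) = negIdx P (act P w i) := by
  apply P.root.injective
  rw [root_act, root_negIdx, root_negIdx, root_act, smul_neg]

@[simp] lemma negIdx_negIdx (i : ι) : negIdx P (negIdx P i) = i := by
  apply P.root.injective
  rw [root_negIdx, root_negIdx, neg_neg]

lemma weylGroup_ext {u v : P.weylGroup} (h : ∀ m : M, u • m = v • m) : u = v := by
  apply Subtype.ext
  apply Equiv.weightHom_injective P
  ext m
  exact h m

@[simp] lemma refl_mul_self (i : ι) : refl P i * refl P i = 1 := by
  apply weylGroup_ext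
  intro m
  rw [mul_smul, one_smul]
  simp

@[simp] lemma refl_inv (i : ι) : (refl P i)⁻¹ = refl P i :=
  inv_eq_of_mul_eq_one_left (refl_mul_self P i)

@[simp] lemma mul_refl_mul_refl (w : P.weylGroup) (i : ι) : w * refl P i * refl P i = w := by
  rw [mul_assoc, refl_mul_self, mul_one]

@[simp] lemma refl_mul_refl_mul (w : P.weylGroup) (i : ι) : refl P i * (refl P i * w) = w := by
  rw [← mul_assoc, refl_mul_self, one_mul]

lemma coroot'_act (w : P.weylGroup) (i : ι) (m : M) :
    P.coroot' (act P w i) (w • m) = P.coroot' i m := by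
  have h1 := Hom.coroot_coweightMap_apply P P (act P w i) w.1.toHom
  have h2 := LinearMap.congr_fun
    (Hom.weight_coweight_transpose_apply P P (P.coroot (act P w i)) w.1.toHom) m
  have h3 : w.1.toHom.indexEquiv.symm (act P w i) = i :=
    w.1.toHom.indexEquiv.symm_apply_apply i
  rw [h1, h3] at h2
  exact h2

lemma pairing_act (w : P.weylGroup) (i j : ι) :
    P.pairing (act P w i) (act P w j) = P.pairing i j := by
  rw [← P.root_coroot'_eq_pairing, ← P.root_coroot'_eq_pairing, root_act, coroot'_act]

/-- This conjugation rule passes between the left reflections of the GKM condition and the right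
reflections of the Bruhat order. -/
lemma mul_refl (w : P.weylGroup) (i : ι) : w * refl P i = refl P (act P w i) * w := by
  apply weylGroup_ext
  intro m
  rw [mul_smul, mul_smul]
  simp only [weylGroup.ofIdx_smul, Equiv.reflection_smul, P.reflection_apply, smul_sub]
  rw [coroot'_act, root_act]
  congr 1
  exact map_smul w.1.toHom.weightMap _ _

lemma refl_mul (w : P.weylGroup) (i : ι) : refl P i * w = w * refl P (act P w⁻¹ i) := by
  rw [mul_refl, act_act_inv]

lemma pairingIn_act [CharZero R] [P.IsCrystallographic] (w : P.weylGroup) (i j : ι) :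
    P.pairingIn ℤ (act P w i) (act P w j) = P.pairingIn ℤ i j := by
  apply FaithfulSMul.algebraMap_injective ℤ R
  rw [P.algebraMap_pairingIn, P.algebraMap_pairingIn, pairing_act]

lemma refl_negIdx (i : ι) : refl P (negIdx P i) = refl P i := by
  have h := mul_refl P (refl P i) i
  rw [act_refl] at h
  rw [refl_mul_self] at h
  exact (eq_inv_of_mul_eq_one_left h.symm).trans (refl_inv P i)

end WeylAction

/-! ### Length, exchange and descents -/

section Length

variable {ι R M N : Type*} [CommRing R] [AddCommGroup M] [Module R M]
  [AddCommGroup N] [Module R N] {P : RootPairing ι R M N} (b : P.Base)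

/-- The product of a word in the simple reflections. -/
def wordProd (l : List b.support) : P.weylGroup := (l.map fun i => refl P i).prod

lemma wordProd_cons (i : b.support) (l : List b.support) :
    wordProd b (i :: l) = refl P i * wordProd b l := by simp [wordProd]

lemma wordProd_append (l l' : List b.support) :
    wordProd b (l ++ l') = wordProd b l * wordProd b l' := by simp [wordProd]

lemma length_le_of_wordProd_eq {l : List b.support} {w : P.weylGroup} (h : wordProd b l = w) :
    length b w ≤ l.length := Nat.sInf_le ⟨l, rfl, h⟩

lemma length_one : length b (1 : P.weylGroup) = 0 := by
  simpa using length_le_of_wordProd_eq b (l := []) (w := 1) rfl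

variable [CharZero R] [Finite ι] [IsDomain R] [P.IsCrystallographic] [P.IsReduced]

lemma exists_wordProd_eq_refl (i : ι) : ∃ l, wordProd b l = refl P i := by
  induction i using b.induction_reflect with
  | h₀ i hi =>
    obtain ⟨l, hl⟩ := hi
    exact ⟨l, hl.trans (refl_negIdx P i).symm⟩
  | h₁ i hi => exact ⟨[⟨i, hi⟩], by simp [wordProd]⟩
  | h₂ i j hi hj =>
    obtain ⟨l, hl⟩ := hi
    refine ⟨⟨j, hj⟩ :: (l ++ [⟨j, hj⟩]), ?_⟩
    rw [wordProd_cons, wordProd_append, hl, ← act_refl, ← mul_assoc, mul_refl]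
    simp [wordProd]

lemma exists_wordProd_eq (w : P.weylGroup) : ∃ l, wordProd b l = w := by
  obtain ⟨w, hw⟩ := w
  induction hw using weylGroup.induction with
  | mem i => exact exists_wordProd_eq_refl b i
  | one => exact ⟨[], rfl⟩
  | mul x y hx hy h1 h2 =>
    obtain ⟨l, hl⟩ := h1
    obtain ⟨l', hl'⟩ := h2
    exact ⟨l ++ l', by rw [wordProd_append, hl, hl']; rfl⟩

lemma exists_reduced_word (w : P.weylGroup) :
    ∃ l : List b.support, l.length = length b w ∧ wordProd b l = w := by
  obtain ⟨l, hl⟩ := exists_wordProd_eq b w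
  exact Nat.sInf_mem (s := {n | ∃ l : List b.support, l.length = n ∧ wordProd b l = w})
    ⟨_, l, rfl, hl⟩

omit [Finite ι] [IsDomain R] [P.IsCrystallographic] [P.IsReduced] in
lemma isPos_negIdx_iff (i : ι) : b.IsPos (negIdx P i) ↔ ¬ b.IsPos i :=
  Base.IsPos.neg_iff_not b i

lemma isPos_act_refl_iff {α γ : ι} (hα : α ∈ b.support) (h1 : γ ≠ α) (h2 : γ ≠ negIdx P α) :
    b.IsPos (act P (refl P α) γ) ↔ b.IsPos γ := by
  by_cases hγ : b.IsPos γ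
  · exact iff_of_true (hγ.reflectionPerm hα h1) hγ
  · have hγ' : b.IsPos (negIdx P γ) := (isPos_negIdx_iff b γ).2 hγ
    have h3 : negIdx P γ ≠ α := fun h => h2 (by rw [← h, negIdx_negIdx])
    have := hγ'.reflectionPerm hα h3
    rw [← act_refl, act_negIdx, isPos_negIdx_iff] at this
    simp [hγ, this]

/-- The exchange property. -/
lemma exists_shorter_word (l : List b.support) {β : ι} (hβ : b.IsPos β)
    (h : ¬ b.IsPos (act P (wordProd b l) β)) :
    ∃ l' : List b.support, l'.length + 1 = l.length ∧ wordProd b l' = wordProd b l * refl P β := by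
  induction l with
  | nil => simp [wordProd, hβ] at h
  | cons i l ih =>
    by_cases h1 : b.IsPos (act P (wordProd b l) β)
    · refine ⟨l, rfl, ?_⟩
      -- The letter `i` turns a positive root negative, and a simple reflection does this only to
      -- its own simple root. This letter can therefore be deleted.
      have h2 : act P (wordProd b l) β = i := by
        by_contra h3
        rw [wordProd_cons, act_mul] at h
        exact h (h1.reflectionPerm i.2 h3)
      rw [wordProd_cons, mul_assoc, mul_refl, h2, refl_mul_refl_mul]
    · obtain ⟨l', h2, h3⟩ := ih h1
      exact ⟨i :: l', by simp [h2], by rw [wordProd_cons, h3, wordProd_cons, mul_assoc]⟩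

lemma length_mul_refl_lt {w : P.weylGroup} {β : ι} (hβ : b.IsPos β)
    (h : ¬ b.IsPos (act P w β)) : length b (w * refl P β) < length b w := by
  obtain ⟨l, hl, rfl⟩ := exists_reduced_word b w
  obtain ⟨l', h1, h2⟩ := exists_shorter_word b l hβ h
  have := length_le_of_wordProd_eq b h2
  lia

lemma length_lt_mul_refl {w : P.weylGroup} {β : ι} (hβ : b.IsPos β)
    (h : b.IsPos (act P w β)) : length b w < length b (w * refl P β) := by
  have := length_mul_refl_lt b (w := w * refl P β) hβ (by
    rw [act_mul, act_refl, act_negIdx, isPos_negIdx_iff]; simpa using h)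
  simpa using this

lemma length_mul_refl_lt_iff {w : P.weylGroup} {β : ι} (hβ : b.IsPos β) :
    length b (w * refl P β) < length b w ↔ ¬ b.IsPos (act P w β) :=
  ⟨fun h h' => h.not_gt (length_lt_mul_refl b hβ h'), length_mul_refl_lt b hβ⟩

lemma length_lt_mul_refl_iff {w : P.weylGroup} {β : ι} (hβ : b.IsPos β) :
    length b w < length b (w * refl P β) ↔ b.IsPos (act P w β) :=
  ⟨fun h => by_contra fun h' => h.not_gt (length_mul_refl_lt b hβ h'), length_lt_mul_refl b hβ⟩

lemma length_refl_mul_lt_iff {w : P.weylGroup} {β : ι} (hβ : b.IsPos β) :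
    length b (refl P β * w) < length b w ↔ ¬ b.IsPos (act P w⁻¹ β) := by
  rw [refl_mul]
  by_cases h : b.IsPos (act P w⁻¹ β)
  · rw [length_mul_refl_lt_iff b h]
    simp [h, hβ]
  · rw [← refl_negIdx, length_mul_refl_lt_iff b ((isPos_negIdx_iff b _).2 h), act_negIdx,
      isPos_negIdx_iff]
    simp [h, hβ]

lemma length_mul_refl_le {α : ι} (hα : α ∈ b.support) (w : P.weylGroup) :
    length b (w * refl P α) ≤ length b w + 1 := by
  obtain ⟨l, hl, rfl⟩ := exists_reduced_word b w
  rw [← hl]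
  have := length_le_of_wordProd_eq b (l := l ++ [⟨α, hα⟩]) (w := wordProd b l * refl P α)
    (by simp [wordProd])
  simpa using this

lemma length_refl_mul_le {α : ι} (hα : α ∈ b.support) (w : P.weylGroup) :
    length b (refl P α * w) ≤ length b w + 1 := by
  obtain ⟨l, hl, rfl⟩ := exists_reduced_word b w
  rw [← hl]
  exact length_le_of_wordProd_eq b (l := ⟨α, hα⟩ :: l) (by simp [wordProd])

lemma length_mul_simple_of_pos {α : ι} (hα : α ∈ b.support) {w : P.weylGroup}
    (h : b.IsPos (act P w α)) : length b (w * refl P α) = length b w + 1 :=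
  le_antisymm (length_mul_refl_le b hα w)
    (length_lt_mul_refl b (Base.isPos_of_mem_support hα) h)

omit [Finite ι] [IsDomain R] [P.IsCrystallographic] [P.IsReduced] in
lemma isPos_act_mul_refl_self (w : P.weylGroup) (α : ι) :
    b.IsPos (act P (w * refl P α) α) ↔ ¬ b.IsPos (act P w α) := by
  rw [act_mul, act_refl, act_negIdx, isPos_negIdx_iff]

lemma length_mul_simple_of_not_pos {α : ι} (hα : α ∈ b.support) {w : P.weylGroup}
    (h : ¬ b.IsPos (act P w α)) : length b (w * refl P α) + 1 = length b w := by
  have := length_mul_simple_of_pos b hα ((isPos_act_mul_refl_self b w α).2 h)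
  simpa using this.symm

lemma exists_right_descent {w : P.weylGroup} (hw : w ≠ 1) :
    ∃ α ∈ b.support, ¬ b.IsPos (act P w α) := by
  obtain ⟨l, hl, rfl⟩ := exists_reduced_word b w
  rcases List.eq_nil_or_concat l with rfl | ⟨l', i, rfl⟩
  · exact absurd rfl hw
  · refine ⟨i, i.2, ?_⟩
    rw [← length_mul_refl_lt_iff b (Base.isPos_of_mem_support i.2), ← hl]
    have := length_le_of_wordProd_eq b (l := l') (w := wordProd b (l'.concat i) * refl P i)
      (by simp [wordProd])
    simp only [List.length_concat]
    lia

lemma exists_left_descent {w : P.weylGroup} (hw : w ≠ 1) :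
    ∃ α ∈ b.support, length b (refl P α * w) + 1 = length b w := by
  obtain ⟨l, hl, rfl⟩ := exists_reduced_word b w
  rcases l with _ | ⟨i, l⟩
  · exact absurd rfl hw
  · refine ⟨i, i.2, ?_⟩
    have h1 := length_le_of_wordProd_eq b (l := l) (w := refl P i * wordProd b (i :: l))
      (by simp [wordProd])
    have h2 := length_refl_mul_le b i.2 (refl P i * wordProd b (i :: l))
    rw [refl_mul_refl_mul] at h2
    simp only [List.length_cons] at hl
    lia

-- An element fixing every root makes no simple root negative, so it has no descent and is trivial.
-- The action on the finite set of roots is thus faithful even if the roots do not span `M`.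
include b in
lemma finite_weylGroup : Finite P.weylGroup := by
  apply Finite.of_injective P.weylGroupToPerm
  rw [injective_iff_map_eq_one]
  intro w hw
  by_contra h
  obtain ⟨α, hα, h1⟩ := exists_right_descent b h
  apply h1
  have : act P w α = α := by simp [act, hw]
  rw [this]
  exact Base.isPos_of_mem_support hα

-- Otherwise `r_γ β = -β` would give the relation `2β = ⟨β,γ⟩γ` between linearly independent roots.
omit [Finite ι] [IsDomain R] [P.IsCrystallographic] in
include b in
lemma eq_of_refl_eq {β γ : ι} (hβ : b.IsPos β) (hγ : b.IsPos γ) (h : refl P β = refl P γ) :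
    β = γ := by
  by_contra hne
  have hne' : P.root β ≠ -P.root γ := by
    rw [← root_negIdx]
    intro h'
    have := P.root.injective h'
    rw [this, isPos_negIdx_iff] at hβ
    exact hβ hγ
  have hli := IsReduced.linearIndependent P hne hne'
  have h1 : P.reflectionPerm γ β = negIdx P β := by rw [← act_refl, ← h, act_refl]
  have h2 : P.root β - P.pairing β γ • P.root γ = -P.root β := by
    rw [← root_negIdx, ← h1, P.root_reflectionPerm, P.reflection_apply_root]
  have h3 := LinearIndependent.pair_iff.1 hli 2 (-P.pairing β γ) (by
    rw [neg_smul, ← sub_eq_add_neg, two_smul, add_sub_assoc, h2, add_neg_cancel])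
  exact two_ne_zero h3.1

end Length

/-! ### Bruhat covers are the reflections raising the length by one -/

section Bruhat

variable {ι R M N : Type*} [CommRing R] [AddCommGroup M] [Module R M]
  [AddCommGroup N] [Module R N] {P : RootPairing ι R M N} (b : P.Base)

/-- A single step in the Bruhat order. -/
def BruhatStep (u v : P.weylGroup) : Prop := ∃ β : ι, v = u * refl P β ∧ length b u < length b v

variable {b} in
lemma BruhatLT.length_lt {u v : P.weylGroup} (h : BruhatLT b u v) : length b u < length b v := by
  induction h with
  | single h => exact h.choose_spec.2
  | tail _ h ih => exact ih.trans h.choose_spec.2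

variable {b} in
lemma BruhatStep.bruhatLT {u v : P.weylGroup} (h : BruhatStep b u v) : BruhatLT b u v :=
  Relation.TransGen.single h

lemma bruhatLT_mul_refl_iff (u : P.weylGroup) (β : ι) :
    BruhatLT b u (u * refl P β) ↔ length b u < length b (u * refl P β) :=
  ⟨BruhatLT.length_lt, fun h => BruhatStep.bruhatLT ⟨β, rfl, h⟩⟩

lemma bruhatStep_refl_mul_iff (u : P.weylGroup) (β : ι) :
    BruhatStep b (refl P β * u) u ↔ length b (refl P β * u) < length b u :=
  ⟨fun h => h.choose_spec.2, fun h => ⟨act P u⁻¹ β, by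
    rw [refl_mul P u β, mul_refl_mul_refl], h⟩⟩

lemma bruhatLT_refl_mul_iff (u : P.weylGroup) (β : ι) :
    BruhatLT b (refl P β * u) u ↔ length b (refl P β * u) < length b u :=
  ⟨BruhatLT.length_lt, fun h => ((bruhatStep_refl_mul_iff b u β).2 h).bruhatLT⟩

variable [CharZero R] [Finite ι] [IsDomain R] [P.IsCrystallographic] [P.IsReduced]

variable {b} in
lemma BruhatStep.exists_pos {u v : P.weylGroup} (h : BruhatStep b u v) :
    ∃ β, b.IsPos β ∧ b.IsPos (act P u β) ∧ v = u * refl P β := by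
  obtain ⟨β, rfl, h⟩ := h
  by_cases hβ : b.IsPos β
  · exact ⟨β, hβ, (length_lt_mul_refl_iff b hβ).1 h, rfl⟩
  · rw [← refl_negIdx] at h ⊢
    rw [← isPos_negIdx_iff] at hβ
    exact ⟨_, hβ, (length_lt_mul_refl_iff b hβ).1 h, rfl⟩

-- The step is upward because `uβ` is positive. A simple reflection keeps it positive unless `uβ =
-- α`, and in that case `v = r_α u`.
variable {b} in
lemma BruhatStep.refl_mul {u v : P.weylGroup} (h : BruhatStep b u v) {α : ι}
    (hα : α ∈ b.support) : BruhatStep b (refl P α * u) (refl P α * v) ∨ refl P α * u = v := by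
  obtain ⟨β, hβ, h1, rfl⟩ := h.exists_pos
  by_cases h2 : act P u β = α
  · right
    rw [mul_refl, h2]
  · left
    refine ⟨β, by rw [mul_assoc], ?_⟩
    rw [← mul_assoc, length_lt_mul_refl_iff b hβ, act_mul]
    exact h1.reflectionPerm hα h2

-- This refines every step of length difference greater than one. Three steps are the natural
-- number: a reflection has determinant `-1`, so `u` and `v` are never joined by two. The induction
-- multiplies on the left by a descent `r_α` of `v`.
variable {b} in
lemma BruhatStep.exists_path {u v : P.weylGroup} (h : BruhatStep b u v)
    (hl : length b u + 1 < length b v) :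
    ∃ x y, BruhatStep b u x ∧ BruhatStep b x y ∧ BruhatStep b y v := by
  induction hn : length b v generalizing u v with
  | zero => lia
  | succ n ih =>
    have hv : v ≠ 1 := by
      rintro rfl
      have := length_le_of_wordProd_eq b (l := []) (w := 1) rfl
      simp at this
      lia
    obtain ⟨α, hα, hd⟩ := exists_left_descent b hv
    have hsv : BruhatStep b (refl P α * v) v := (bruhatStep_refl_mul_iff b v α).2 (by lia)
    have hle := length_refl_mul_le b hα u
    have hne : refl P α * u ≠ v := by
      intro h'
      rw [h'] at hle
      lia
    have hs := (h.refl_mul hα).resolve_right hne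
    have hle' := length_refl_mul_le b hα (refl P α * u)
    rw [refl_mul_refl_mul] at hle'
    rcases lt_or_ge (length b u) (length b (refl P α * u)) with hlt | hge
    · refine ⟨refl P α * u, refl P α * v, ?_, hs, hsv⟩
      exact ⟨act P u⁻¹ α, by rw [Schubert.refl_mul], hlt⟩
    -- Here `r_α` shortens both ends, so the gap is unchanged and induction applies to `r_α u` and
    -- `r_α v`. Lifting that path back by `r_α` may collapse one of its first two steps; the step
    -- from `r_α v` to `v` then makes up for the loss.
    · have hlt : length b (refl P α * u) < length b u := by
        have h1 := length_refl_mul_lt_iff b (w := u) (Base.isPos_of_mem_support hα)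
        have h2 := length_refl_mul_lt_iff b (w := refl P α * u) (Base.isPos_of_mem_support hα)
        rw [refl_mul_refl_mul, mul_inv_rev, refl_inv, isPos_act_mul_refl_self] at h2
        by_contra h3
        rw [h1] at h3
        have := h2.2 h3
        lia
      obtain ⟨x, y, h1, h2, h3⟩ := ih hs (by lia) (by lia)
      have g1 := h1.refl_mul hα
      have g2 := h2.refl_mul hα
      have g3 := h3.refl_mul hα
      rw [refl_mul_refl_mul] at g1 g3
      have hyl := h3.bruhatLT.length_lt
      rcases g3 with g3 | g3
      · rcases g1 with g1 | rfl
        · rcases g2 with g2 | rfl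
          · exact ⟨_, _, g1, g2, g3⟩
          · exact ⟨_, _, g1, h3, hsv⟩
        · exact ⟨_, _, h2, h3, hsv⟩
      · have := mul_left_cancel g3
        rw [this] at hyl
        lia

lemma bruhatCovers_mul_refl_iff (u : P.weylGroup) (β : ι) :
    BruhatCovers b (u * refl P β) u ↔ length b (u * refl P β) = length b u + 1 := by
  constructor
  · rintro ⟨h1, h2⟩
    have h3 := (bruhatLT_mul_refl_iff b u β).1 h1
    by_contra h4
    obtain ⟨x, y, g1, g2, g3⟩ := BruhatStep.exists_path ⟨β, rfl, h3⟩ (by lia)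
    exact h2 x ⟨g1.bruhatLT, g2.bruhatLT.trans g3.bruhatLT⟩
  · intro h
    refine ⟨(bruhatLT_mul_refl_iff b u β).2 (by lia), ?_⟩
    rintro x ⟨h1, h2⟩
    have := h1.length_lt
    have := h2.length_lt
    lia

end Bruhat

/-! ### Inversion sets and length -/

section Inversions

variable {ι R M N : Type*} [CommRing R] [AddCommGroup M] [Module R M]
  [AddCommGroup N] [Module R N] {P : RootPairing ι R M N} (b : P.Base)
  [CharZero R] [Fintype ι] [IsDomain R] [P.IsCrystallographic] [P.IsReduced]

lemma mem_coverRoots {u : P.weylGroup} {β : ι} :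
    β ∈ coverRoots b u ↔ b.IsPos β ∧ length b (u * refl P β) = length b u + 1 := by
  simp [coverRoots, bruhatCovers_mul_refl_iff]

lemma mem_inversions {w : P.weylGroup} {β : ι} :
    β ∈ inversions b w ↔ b.IsPos β ∧ ¬ b.IsPos (act P w⁻¹ β) := by
  simp only [inversions, Finset.mem_filter, Finset.mem_univ, true_and, bruhatLT_refl_mul_iff]
  exact and_congr_right fun h => length_refl_mul_lt_iff b h

lemma notMem_inversions {w : P.weylGroup} {α : ι} (hα : α ∈ b.support) :
    act P w α ∉ inversions b w := by
  rw [mem_inversions, act_inv_act]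
  exact fun h => h.2 (Base.isPos_of_mem_support hα)

-- Since `r_α` permutes the positive roots other than `α`, the two inversion sets differ only in
-- `wα`.
open scoped Classical in
lemma inversions_mul_refl {w : P.weylGroup} {α : ι} (hα : α ∈ b.support)
    (h : b.IsPos (act P w α)) :
    inversions b (w * refl P α) = insert (act P w α) (inversions b w) := by
  ext β
  rw [Finset.mem_insert, mem_inversions, mem_inversions, mul_inv_rev, refl_inv, act_mul]
  by_cases h1 : β = act P w α
  · subst h1
    simp [h, act_refl, isPos_negIdx_iff, Base.isPos_of_mem_support hα]
  · simp only [h1, false_or]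
    refine and_congr_right fun hβ => not_congr (isPos_act_refl_iff b hα ?_ ?_)
    · rintro rfl
      simp at h1
    · intro h2
      have h3 : β = negIdx P (act P w α) := by rw [← act_negIdx, ← h2, act_act_inv]
      rw [h3, isPos_negIdx_iff] at hβ
      exact hβ h

lemma card_inversions (w : P.weylGroup) : (inversions b w).card = length b w := by
  classical
  induction hn : length b w generalizing w with
  | zero =>
    obtain ⟨l, hl, rfl⟩ := exists_reduced_word b w
    rw [hn, List.length_eq_zero_iff] at hl
    subst hl
    rw [Finset.card_eq_zero, Finset.eq_empty_iff_forall_notMem]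
    intro β
    rw [mem_inversions]
    simp [wordProd]
  | succ n ih =>
    have hw : w ≠ 1 := by
      rintro rfl
      rw [length_one] at hn
      lia
    obtain ⟨α, hα, h⟩ := exists_right_descent b hw
    have h1 := length_mul_simple_of_not_pos b hα h
    rw [← mul_refl_mul_refl P w α, inversions_mul_refl b hα ((isPos_act_mul_refl_self b w α).2 h),
      Finset.card_insert_of_notMem (notMem_inversions b hα), ih _ (by lia)]

end Inversions

/-! ### Homogeneous factors of polynomials -/

section Homogeneous

open MvPolynomial

variable {σ k : Type*} [CommRing k] [IsDomain k]

lemma homogeneousComponent_mul_of_isHomogeneous {x : MvPolynomial σ k} {m : ℕ}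
    (hx : x.IsHomogeneous m) (q : MvPolynomial σ k) (j : ℕ) :
    homogeneousComponent (m + j) (x * q) = x * homogeneousComponent j q := by
  let _ := MvPolynomial.gradedAlgebra (σ := σ) (R := k)
  have h := DirectSum.coe_decompose_mul_add_of_left_mem (homogeneousSubmodule σ k) (i := m)
    (j := j) (a := x) (b := q) hx
  have h1 (φ : MvPolynomial σ k) (i : ℕ) :
      (DirectSum.decompose (homogeneousSubmodule σ k) φ i : MvPolynomial σ k) =
        homogeneousComponent i φ := decomposition.decompose'_apply φ i
  rwa [h1, h1] at h

lemma isHomogeneous_of_mul {x q : MvPolynomial σ k} {m n : ℕ} (hx : x.IsHomogeneous m)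
    (hx0 : x ≠ 0) (h : (x * q).IsHomogeneous (m + n)) : q.IsHomogeneous n := by
  have h1 : q = homogeneousComponent n q := by
    apply mul_left_cancel₀ hx0
    rw [← homogeneousComponent_mul_of_isHomogeneous hx, homogeneousComponent_eq_self h]
  rw [h1]
  exact homogeneousComponent_isHomogeneous n q

end Homogeneous

/-! ### GKM classes over abstract root forms and divided differences -/

section LocalClasses

variable {ι R M N : Type*} [CommRing R] [AddCommGroup M] [Module R M]
  [AddCommGroup N] [Module R N] {P : RootPairing ι R M N}

/-- The condition on a list of ring elements to be a class, with respect to given values of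
the roots. -/
def IsGKM {A : Type*} [CommRing A] (x : ι → A) (p : P.weylGroup → A) : Prop :=
  ∀ v β, x β ∣ p v - p (refl P β * v)

section Ring

variable {A : Type*} [CommRing A] {x : ι → A} {p q : P.weylGroup → A}

lemma IsGKM.add (hp : IsGKM x p) (hq : IsGKM x q) : IsGKM x (fun v => p v + q v) :=
  fun v β => by simpa only [add_sub_add_comm] using dvd_add (hp v β) (hq v β)

lemma IsGKM.neg (hp : IsGKM x p) : IsGKM x (fun v => - p v) :=
  fun v β => by simpa only [neg_sub_neg, neg_sub] using (dvd_neg.2 (hp v β))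

lemma IsGKM.sub (hp : IsGKM x p) (hq : IsGKM x q) : IsGKM x (fun v => p v - q v) := by
  simpa only [sub_eq_add_neg] using hp.add hq.neg

lemma isGKM_const (c : A) : IsGKM x (fun _ : P.weylGroup => c) := fun v β => by simp

lemma IsGKM.mul (hp : IsGKM x p) (hq : IsGKM x q) : IsGKM x (fun v => p v * q v) := by
  intro v β
  have h : p v * q v - p (refl P β * v) * q (refl P β * v) =
      (p v - p (refl P β * v)) * q v + p (refl P β * v) * (q v - q (refl P β * v)) := by ring
  simp only [h]
  exact dvd_add ((hp v β).mul_right _) ((hq v β).mul_left _)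

lemma IsGKM.sum {κ : Type*} (s : Finset κ) {f : κ → P.weylGroup → A}
    (h : ∀ i ∈ s, IsGKM x (f i)) : IsGKM x (fun v => ∑ i ∈ s, f i v) := by
  intro v β
  simp only [← Finset.sum_sub_distrib]
  exact Finset.dvd_sum fun i hi => h i hi v β

end Ring

variable [CharZero R] [P.IsCrystallographic]

/-- Homogeneous linear forms that behave like the roots of `P`, and are pairwise coprime
primes up to sign. -/
structure IsRootForms {σ k : Type*} [CommRing k] (P : RootPairing ι R M N)
    [P.IsCrystallographic] (x : ι → MvPolynomial σ k) : Prop where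
  prime : ∀ i, Prime (x i)
  isHomogeneous : ∀ i, (x i).IsHomogeneous 1
  eq_or_eq_negIdx : ∀ i j, x i ∣ x j → j = i ∨ j = negIdx P i
  reflectionPerm : ∀ β γ, x (P.reflectionPerm β γ) = x γ - P.pairingIn ℤ γ β • x β

variable {σ k : Type*} [CommRing k] [IsDomain k] {x : ι → MvPolynomial σ k}
  (hx : IsRootForms P x)

include hx

namespace IsRootForms

lemma ne_zero (i : ι) : x i ≠ 0 := (hx.prime i).ne_zero

lemma apply_negIdx (i : ι) : x (negIdx P i) = - x i := by
  rw [hx.reflectionPerm]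
  simp [two_smul]

lemma apply_act_refl (β γ : ι) : x (act P (refl P β) γ) = x γ - P.pairingIn ℤ γ β • x β :=
  hx.reflectionPerm β γ

lemma isGKM_act (α : ι) : IsGKM x (fun v : P.weylGroup => x (act P v α)) := by
  intro v β
  dsimp only
  rw [act_mul, hx.apply_act_refl, sub_sub_cancel, zsmul_eq_mul]
  exact Dvd.intro_left _ rfl

/-- Divided differences preserve classes. -/
lemma exists_dividedDifference {p : P.weylGroup → MvPolynomial σ k} (hp : IsGKM x p) (α : ι) :
    ∃ q, IsGKM x q ∧ ∀ v, p v - p (v * refl P α) = -(x (act P v α) * q v) := by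
  have h1 (v : P.weylGroup) : ∃ c, p v - p (v * refl P α) = -(x (act P v α) * c) := by
    obtain ⟨c, hc⟩ := hp v (act P v α)
    refine ⟨-c, ?_⟩
    rw [mul_refl, hc]
    ring
  choose q hq using h1
  refine ⟨q, fun v β => ?_, hq⟩
  by_cases h : act P v α = β ∨ act P v α = negIdx P β
  · have h2 : refl P β = refl P (act P v α) := by
      rcases h with h | h <;> rw [h]
      rw [refl_negIdx]
    have h3 : refl P β * v = v * refl P α := by rw [h2, mul_refl]
    -- Here `r_β v = v r_α`. The defining equation at `v r_α` is the one at `v` with both signs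
    -- reversed, so `q` takes equal values at the two elements.
    have h4 := hq (v * refl P α)
    rw [mul_refl_mul_refl, act_mul, act_refl, act_negIdx, hx.apply_negIdx] at h4
    have h5 : x (act P v α) * (q v - q (v * refl P α)) = 0 := by
      linear_combination hq v + h4
    rw [h3, (mul_eq_zero.1 h5).resolve_left (hx.ne_zero _)]
    exact dvd_zero _
  · have h2 : ¬ x β ∣ x (act P v α) := fun h3 => h (hx.eq_or_eq_negIdx _ _ h3)
    have h3 := hq v
    have h4 := hq (refl P β * v)
    rw [act_mul, hx.apply_act_refl, mul_assoc] at h4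
    have h5 := dvd_sub (hp v β) (hp (v * refl P α) β)
    -- As `x β` is a prime not dividing `x (vα)`, divisibility may be tested after multiplying by `x
    -- (vα)`, which agrees with `x (r_β v α)` modulo `x β`.
    refine ((hx.prime β).dvd_or_dvd ?_).resolve_left h2
    set n := P.pairingIn ℤ (act P v α) β
    have h6 : x (act P v α) * (q v - q (refl P β * v)) =
        -((p v - p (refl P β * v)) - (p (v * refl P α) - p (refl P β * (v * refl P α))))
          - x β * (n • q (refl P β * v)) := by
      rw [zsmul_eq_mul] at h4 ⊢
      linear_combination h3 - h4
    rw [h6]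
    exact dvd_sub (dvd_neg.2 h5) (dvd_mul_right _ _)

variable (b : P.Base) [Fintype ι] [IsDomain R] [P.IsReduced] [UniqueFactorizationMonoid k]

/-- Positivity excludes opposite pairs, so distinct factors are nonassociated primes. -/
lemma prod_dvd (s : Finset ι) (hs : ∀ i ∈ s, b.IsPos i) {p : MvPolynomial σ k}
    (h : ∀ i ∈ s, x i ∣ p) : ∏ i ∈ s, x i ∣ p := by
  apply Finset.prod_dvd_of_isRelPrime _ h
  intro i hi j hj hij
  rw [Function.onFun, (hx.prime i).irreducible.isRelPrime_iff_not_dvd]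
  intro h1
  rcases hx.eq_or_eq_negIdx _ _ h1 with h2 | h2
  · exact hij h2.symm
  · have h3 := hs j hj
    rw [h2, isPos_negIdx_iff] at h3
    exact h3 (hs i hi)

lemma isHomogeneous_prod_inversions (w : P.weylGroup) :
    (∏ β ∈ inversions b w, x β).IsHomogeneous (length b w) := by
  have := MvPolynomial.IsHomogeneous.prod (inversions b w) x (fun _ => 1)
    (fun i _ => hx.isHomogeneous i)
  simpa [card_inversions] using this

lemma prod_inversions_ne_zero (w : P.weylGroup) : ∏ β ∈ inversions b w, x β ≠ 0 :=
  Finset.prod_ne_zero_iff.2 fun i _ => hx.ne_zero i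

/-- A homogeneous class whose degree at `v` is smaller than the length of `v` vanishes at `v`
if it vanishes at all smaller elements. -/
lemma eq_zero_of_forall_lower {p : P.weylGroup → MvPolynomial σ k} (hp : IsGKM x p)
    {d : ℕ} {v : P.weylGroup} (hd : (p v).IsHomogeneous d) (hv : d < length b v)
    (h : ∀ β, b.IsPos β → length b (refl P β * v) < length b v → p (refl P β * v) = 0) :
    p v = 0 := by
  have h1 : ∏ β ∈ inversions b v, x β ∣ p v := by
    apply hx.prod_dvd b _ (fun i hi => ((mem_inversions b).1 hi).1)
    intro β hβ
    obtain ⟨hβ, hβ'⟩ := (mem_inversions b).1 hβ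
    rw [← length_refl_mul_lt_iff b hβ] at hβ'
    have h2 := hp v β
    rwa [h β hβ hβ', sub_zero] at h2
  by_contra h0
  -- A nonzero `p v` of degree `d` would have a divisor of degree `l(v) > d`.
  have h3 := MvPolynomial.totalDegree_le_of_dvd_of_isDomain h1 h0
  rw [hd.totalDegree h0, (hx.isHomogeneous_prod_inversions b v).totalDegree
    (hx.prod_inversions_ne_zero b v)] at h3
  lia

/-- A homogeneous class of degree `d` that vanishes at all elements of length at most `d` is
zero. -/
lemma eq_zero_of_forall_length_le {p : P.weylGroup → MvPolynomial σ k} (hp : IsGKM x p)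
    {d : ℕ} (hd : ∀ v, (p v).IsHomogeneous d) (h : ∀ v, length b v ≤ d → p v = 0)
    (v : P.weylGroup) : p v = 0 := by
  induction hn : length b v using Nat.strong_induction_on generalizing v with
  | h n ih =>
    rcases le_or_gt (length b v) d with h1 | h1
    · exact h v h1
    · exact hx.eq_zero_of_forall_lower b hp (hd v) h1 fun β _ h2 => ih _ (hn ▸ h2) _ rfl

end IsRootForms

omit hx in
/-- The conditions characterizing the Schubert class of `w`, with respect to given values of
the roots. -/
structure IsLocalSchubert [Fintype ι] (b : P.Base) (x : ι → MvPolynomial σ k) (w : P.weylGroup)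
    (p : P.weylGroup → MvPolynomial σ k) : Prop where
  isGKM : IsGKM x p
  isHomogeneous : ∀ v, (p v).IsHomogeneous (length b w)
  vanishing : ∀ v, length b v ≤ length b w → v ≠ w → p v = 0
  value : p w = ∏ β ∈ inversions b w, x β

/-! ### Existence and uniqueness of Schubert classes, and the Chevalley formula -/

namespace IsRootForms

variable (b : P.Base) [Fintype ι] [IsDomain R] [P.IsReduced] [UniqueFactorizationMonoid k]

lemma isLocalSchubert_unique {w : P.weylGroup} {p q : P.weylGroup → MvPolynomial σ k}
    (hp : IsLocalSchubert b x w p) (hq : IsLocalSchubert b x w q) : p = q := by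
  funext v
  rw [← sub_eq_zero]
  refine hx.eq_zero_of_forall_length_le b (hp.isGKM.sub hq.isGKM)
    (fun u => (hp.isHomogeneous u).sub (hq.isHomogeneous u)) (fun u hu => ?_) v
  by_cases h : u = w
  · rw [h, hp.value, hq.value, sub_self]
  · rw [hp.vanishing u hu h, hq.vanishing u hu h, sub_self]

/-- The minus sign in the divided difference is there for the normalization: at `w r_α` the divisor
is the positive root `w r_α α`, which is exactly the inversion of `w` that `w r_α` lacks. -/
lemma isLocalSchubert_dividedDifference {w : P.weylGroup} {α : ι} (hα : α ∈ b.support)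
    (h : ¬ b.IsPos (act P w α)) {p q : P.weylGroup → MvPolynomial σ k}
    (hp : IsLocalSchubert b x w p) (hq : IsGKM x q)
    (hpq : ∀ v, p v - p (v * refl P α) = -(x (act P v α) * q v)) :
    IsLocalSchubert b x (w * refl P α) q := by
  classical
  have hl := length_mul_simple_of_not_pos b hα h
  refine ⟨hq, fun v => ?_, fun v hv hne => ?_, ?_⟩
  · apply isHomogeneous_of_mul (hx.isHomogeneous (act P v α)) (hx.ne_zero _)
    rw [← neg_neg (_ * _), ← hpq, add_comm, hl]
    exact ((hp.isHomogeneous _).sub (hp.isHomogeneous _)).neg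
  · have h1 : p v = 0 := hp.vanishing v (by lia) (by rintro rfl; lia)
    have h2 : p (v * refl P α) = 0 := by
      apply hp.vanishing
      · have := length_mul_refl_le b hα v
        lia
      · rintro rfl
        simp at hne
    have h3 := hpq v
    rw [h1, h2, sub_zero, zero_eq_neg, mul_eq_zero] at h3
    exact h3.resolve_left (hx.ne_zero _)
  · have h1 : p (w * refl P α) = 0 := hp.vanishing _ (by lia) (by intro h'; rw [h'] at hl; lia)
    have h2 := hpq (w * refl P α)
    have h3 := inversions_mul_refl b hα ((isPos_act_mul_refl_self b w α).2 h)
    rw [mul_refl_mul_refl] at h2 h3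
    rw [h1, hp.value, h3, Finset.prod_insert (notMem_inversions b hα), zero_sub, neg_inj] at h2
    exact (mul_left_cancel₀ (hx.ne_zero _) h2).symm

-- A positive root is built by adding simple roots one at a time through roots, and negativity of
-- the images is preserved under such sums.
omit hx [IsDomain k] [UniqueFactorizationMonoid k] in
lemma not_isPos_act_of_forall_simple {w : P.weylGroup}
    (h : ∀ α ∈ b.support, ¬ b.IsPos (act P w α)) {β : ι} (hβ : b.IsPos β) :
    ¬ b.IsPos (act P w β) := by
  refine hβ.induction_on_add h fun i j l hl hi hj => ?_
  have hj := h j hj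
  rw [← isPos_negIdx_iff] at hi hj ⊢
  apply hi.add hj
  rw [root_negIdx, root_negIdx, root_negIdx, root_act, root_act, root_act, hl, smul_add, neg_add]

open scoped Classical in
/-- The Schubert class of the longest element. -/
lemma isLocalSchubert_longest {w : P.weylGroup} (h : ∀ α ∈ b.support, ¬ b.IsPos (act P w α)) :
    IsLocalSchubert b x w (fun v => if v = w then ∏ β ∈ inversions b w, x β else 0) := by
  -- All positive roots are inversions of the longest element, so the single nonzero value is
  -- divisible by every root and the GKM condition follows.
  have hd (β : ι) : x β ∣ ∏ β ∈ inversions b w, x β := by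
    have hp {β : ι} (hβ : b.IsPos β) : β ∈ inversions b w := by
      rw [mem_inversions]
      refine ⟨hβ, fun h' => ?_⟩
      have := not_isPos_act_of_forall_simple b h h'
      rw [act_act_inv] at this
      exact this hβ
    by_cases hβ : b.IsPos β
    · exact Finset.dvd_prod_of_mem x (hp hβ)
    · rw [← isPos_negIdx_iff] at hβ
      have := Finset.dvd_prod_of_mem x (hp hβ)
      rwa [hx.apply_negIdx, neg_dvd] at this
  refine ⟨fun v β => ?_, fun v => ?_, fun v _ hv => if_neg hv, if_pos rfl⟩
  · apply dvd_sub <;> split_ifs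
    exacts [hd β, dvd_zero _, hd β, dvd_zero _]
  · split_ifs
    exacts [hx.isHomogeneous_prod_inversions b w, MvPolynomial.isHomogeneous_zero _ _ _]

/-- Lengths are bounded because the group is finite, so one can induct downward on length. An
element with an ascent `α` gets its class as a divided difference of the class of `w r_α`; an
element without ascents is the longest one. -/
lemma exists_isLocalSchubert (w : P.weylGroup) : ∃ p, IsLocalSchubert b x w p := by
  have := finite_weylGroup b
  obtain ⟨m, hm⟩ := (Set.finite_range (length b : P.weylGroup → ℕ)).bddAbove
  have hm' (v : P.weylGroup) : length b v ≤ m := hm ⟨v, rfl⟩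
  induction hn : m - length b w using Nat.strong_induction_on generalizing w with
  | h n ih =>
    by_cases h : ∃ α ∈ b.support, b.IsPos (act P w α)
    · obtain ⟨α, hα, h⟩ := h
      have h1 := length_mul_simple_of_pos b hα h
      have h2 := hm' (w * refl P α)
      obtain ⟨p, hp⟩ := ih _ (by lia) (w * refl P α) rfl
      obtain ⟨q, hq, hpq⟩ := hx.exists_dividedDifference hp.isGKM α
      have h3 := hx.isLocalSchubert_dividedDifference b hα (by
        rwa [isPos_act_mul_refl_self, not_not]) hp hq hpq
      rw [mul_refl_mul_refl] at h3
      exact ⟨q, h3⟩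
    · push Not at h
      exact ⟨_, hx.isLocalSchubert_longest b h⟩

variable {S : P.weylGroup → P.weylGroup → MvPolynomial σ k}
  (hS : ∀ w, IsLocalSchubert b x w (S w))

include hS

/-- By uniqueness, the divided difference of `S_w` is the given class `S_{w r_α}`. -/
lemma schubert_sub_right {w : P.weylGroup} {α : ι} (hα : α ∈ b.support)
    (h : ¬ b.IsPos (act P w α)) (v : P.weylGroup) :
    S w v - S w (v * refl P α) = -(x (act P v α) * S (w * refl P α) v) := by
  obtain ⟨q, hq, hpq⟩ := hx.exists_dividedDifference (hS w).isGKM α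
  rw [hx.isLocalSchubert_unique b (hS (w * refl P α))
    (hx.isLocalSchubert_dividedDifference b hα h (hS w) hq hpq)]
  exact hpq v

/-- The divided difference has degree `l(w) - 1` and vanishes at all elements of length at most
`l(w) - 1`, hence everywhere. For `l(w) = 0` the difference is instead a constant divisible by a
linear form. -/
lemma schubert_mul_refl_of_isPos {w : P.weylGroup} {α : ι} (hα : α ∈ b.support)
    (h : b.IsPos (act P w α)) (v : P.weylGroup) : S w (v * refl P α) = S w v := by
  obtain ⟨q, hq, hpq⟩ := hx.exists_dividedDifference (hS w).isGKM α
  have hl := length_mul_simple_of_pos b hα h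
  suffices hz : S w v - S w (v * refl P α) = 0 from (sub_eq_zero.1 hz).symm
  have hh (u : P.weylGroup) := ((hS w).isHomogeneous u).sub
    ((hS w).isHomogeneous (u * refl P α))
  rcases hn : length b w with _ | n
  · by_contra h0
    have h1 : x (act P v α) ∣ S w v - S w (v * refl P α) :=
      ⟨-q v, by rw [hpq]; ring⟩
    have h2 := MvPolynomial.totalDegree_le_of_dvd_of_isDomain h1 h0
    rw [(hh v).totalDegree h0, (hx.isHomogeneous _).totalDegree (hx.ne_zero _)] at h2
    lia
  · have hz : q v = 0 := by
      refine hx.eq_zero_of_forall_length_le b hq (d := n) (fun u => ?_) (fun u hu => ?_) v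
      · apply isHomogeneous_of_mul (hx.isHomogeneous (act P u α)) (hx.ne_zero _)
        rw [← neg_neg (_ * _), ← hpq, add_comm, ← hn]
        exact (hh u).neg
      · have h1 : S w u = 0 := (hS w).vanishing u (by lia) (by rintro rfl; lia)
        have h2 : S w (u * refl P α) = 0 := by
          apply (hS w).vanishing
          · have := length_mul_refl_le b hα u
            lia
          · rintro rfl
            rw [mul_refl_mul_refl] at hl
            lia
        have h3 := hpq u
        rw [h1, h2, sub_zero, zero_eq_neg, mul_eq_zero] at h3
        exact h3.resolve_left (hx.ne_zero _)
    rw [hpq, hz, mul_zero, neg_zero]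

/-- The value of a Schubert class at an element that covers its index. -/
lemma schubert_value_cover {u : P.weylGroup} {β : ι} (hβ : b.IsPos β)
    (hl : length b (u * refl P β) = length b u + 1) :
    S (u * refl P β) (u * refl P β) = x (act P u β) * S u (u * refl P β) := by
  induction hn : length b u using Nat.strong_induction_on generalizing u β with
  | h n ih =>
    have hv : u * refl P β ≠ 1 := by
      intro h
      rw [h, length_one] at hl
      lia
    obtain ⟨α, hα, hd⟩ := exists_right_descent b hv
    have hdl := length_mul_simple_of_not_pos b hα hd
    have hne : u * refl P β ≠ u := by
      intro h
      rw [h] at hl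
      lia
    have hvu : S (u * refl P β) u = 0 := (hS _).vanishing u (by lia) hne.symm
    by_cases hαβ : β = α
    · subst hαβ
      have h1 := hx.schubert_sub_right b hS hα hd (u * refl P β)
      rw [mul_refl_mul_refl, hvu, act_mul, act_refl, act_negIdx, hx.apply_negIdx] at h1
      linear_combination h1
    · have hβ' : b.IsPos (act P (refl P α) β) := hβ.reflectionPerm hα hαβ
      have huβ : b.IsPos (act P u β) := (length_lt_mul_refl_iff b hβ).1 (by lia)
      have hcomm : u * refl P α * refl P (act P (refl P α) β) = u * refl P β * refl P α := by
        rw [mul_assoc, mul_assoc, Schubert.refl_mul P (refl P α) β, refl_inv]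
      have hact : act P (u * refl P α) (act P (refl P α) β) = act P u β := by
        rw [← act_mul, mul_refl_mul_refl]
      -- The descent `α` of `u r_β` is also one of `u`: otherwise `u r_β r_α` would be longer than
      -- `u r_α`, which already has the length of `u r_β`.
      have huα : ¬ b.IsPos (act P u α) := by
        intro h
        have h1 := length_mul_simple_of_pos b hα h
        have h2 := length_lt_mul_refl b (w := u * refl P α) hβ' (by rwa [hact])
        rw [hcomm] at h2
        lia
      have hul := length_mul_simple_of_not_pos b hα huα
      have hu0 : S u (u * refl P β * refl P α) = 0 := by
        apply (hS u).vanishing _ (by lia)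
        intro h
        have h1 : u * refl P β = u * refl P α := by
          rw [← h, mul_refl_mul_refl, h]
        exact hαβ (eq_of_refl_eq b hβ (Base.isPos_of_mem_support hα) (mul_left_cancel h1))
      have hv0 : S (u * refl P β) (u * refl P β * refl P α) = 0 :=
        (hS _).vanishing _ (by lia) (by intro h; rw [h] at hdl; lia)
      -- The induction hypothesis concerns the cover `u r_β r_α` of `u r_α`. Both classes in it are
      -- `r_α`-invariant, so it may be evaluated at `u r_β`; multiplying by the root `u r_β α`
      -- returns to the original pair.
      have h1 := ih _ (by lia) (u := u * refl P α) hβ' (by rw [hcomm]; lia) rfl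
      rw [hcomm, hact, hx.schubert_mul_refl_of_isPos b hS hα
        ((isPos_act_mul_refl_self b _ _).2 hd), hx.schubert_mul_refl_of_isPos b hS hα
        ((isPos_act_mul_refl_self b _ _).2 huα)] at h1
      have h2 := hx.schubert_sub_right b hS hα hd (u * refl P β)
      have h3 := hx.schubert_sub_right b hS hα huα (u * refl P β)
      rw [hv0] at h2
      rw [hu0] at h3
      linear_combination h2 - x (act P (u * refl P β) α) * h1 - x (act P u β) * h3

/-- Every shorter `r_β v` has length at most `l(u)` and differs from `u`, so `S_u` vanishes there,
and `eq_zero_of_forall_lower` applies. -/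
lemma schubert_eq_zero_of_not_cover {u v : P.weylGroup} (hl : length b v = length b u + 1)
    (h : ∀ β ∈ coverRoots b u, v ≠ u * refl P β) : S u v = 0 := by
  refine hx.eq_zero_of_forall_lower b (hS u).isGKM ((hS u).isHomogeneous v) (by lia)
    fun β hβ h1 => (hS u).vanishing _ (by lia) ?_
  rintro rfl
  set γ := act P (refl P β * v)⁻¹ β with hγ
  have h3 : v = refl P β * v * refl P γ := by rw [hγ, ← refl_mul, refl_mul_refl_mul]
  by_cases h4 : b.IsPos γ
  · exact h γ ((mem_coverRoots b).2 ⟨h4, by rw [← h3, hl]⟩) h3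
  · rw [← isPos_negIdx_iff] at h4
    rw [← refl_negIdx P γ] at h3
    exact h _ ((mem_coverRoots b).2 ⟨h4, by rw [← h3, hl]⟩) h3

/-- The equivariant Chevalley formula. -/
lemma root_mul_schubert (u : P.weylGroup) (α : ι) (v : P.weylGroup) :
    x (act P v α) * S u v = x (act P u α) * S u v -
      ∑ β ∈ coverRoots b u, P.pairingIn ℤ α β • S (u * refl P β) v := by
  classical
  have hcov {β : ι} (hβ : β ∈ coverRoots b u) :
      length b (u * refl P β) = length b u + 1 := ((mem_coverRoots b).1 hβ).2
  rw [← sub_eq_zero]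
  revert v
  -- The difference of the two sides is a class of degree `l(u) + 1`, so only `v` with `l(v) ≤ l(u)
  -- + 1` remain: the covers of `u`, `u` itself, and elements where all terms vanish.
  apply hx.eq_zero_of_forall_length_le b (d := length b u + 1)
  · refine ((hx.isGKM_act α).mul (hS u).isGKM).sub
      (((isGKM_const _).mul (hS u).isGKM).sub (IsGKM.sum _ fun β _ => ?_))
    simp only [zsmul_eq_mul]
    exact (isGKM_const _).mul (hS _).isGKM
  · intro v
    have h1 (γ : ι) : (x γ * S u v).IsHomogeneous (length b u + 1) := by
      rw [add_comm]
      exact (hx.isHomogeneous γ).mul ((hS u).isHomogeneous v)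
    refine (h1 _).sub ((h1 _).sub (MvPolynomial.IsHomogeneous.sum _ _ _ fun β hβ => ?_))
    rw [← hcov hβ]
    exact (MvPolynomial.homogeneousSubmodule σ k _).toAddSubgroup.zsmul_mem
      ((hS (u * refl P β)).isHomogeneous v) _
  · intro v hv
    by_cases hex : ∃ β ∈ coverRoots b u, v = u * refl P β
    · obtain ⟨β, hβ, rfl⟩ := hex
      rw [Finset.sum_eq_single_of_mem β hβ]
      -- At the cover `u r_β` only its own term of the sum survives, and the roots `vα` and `uα`
      -- differ by `⟨α,β⟩ uβ`.
      · have h1 : x (act P (u * refl P β) α) =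
            x (act P u α) - P.pairingIn ℤ α β • x (act P u β) := by
          rw [mul_refl, act_mul, hx.apply_act_refl, pairingIn_act]
        rw [hx.schubert_value_cover b hS ((mem_coverRoots b).1 hβ).1 (hcov hβ), h1, zsmul_eq_mul,
          zsmul_eq_mul]
        ring
      · intro γ hγ hne
        rw [(hS (u * refl P γ)).vanishing _ (by rw [hcov hβ, hcov hγ]) ?_, smul_zero]
        intro h
        exact hne (eq_of_refl_eq b ((mem_coverRoots b).1 hγ).1 ((mem_coverRoots b).1 hβ).1
          (mul_left_cancel h.symm))
    · push Not at hex
      rw [Finset.sum_eq_zero, sub_zero]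
      · by_cases hvu : v = u
        · rw [hvu, sub_self]
        · have : S u v = 0 := by
            rcases Nat.lt_or_ge (length b u) (length b v) with h | h
            · exact hx.schubert_eq_zero_of_not_cover b hS (by lia) hex
            · exact (hS u).vanishing v h hvu
          rw [this, mul_zero, mul_zero, sub_zero]
      · intro β hβ
        rw [(hS (u * refl P β)).vanishing v (by rw [hcov hβ]; exact hv) (hex β hβ), smul_zero]

/-- The action of a simple reflection on the Schubert classes. -/
lemma schubert_mul_refl {w : P.weylGroup} {α : ι} (hα : α ∈ b.support)
    (h : ¬ b.IsPos (act P w α)) (v : P.weylGroup) :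
    S w (v * refl P α) = S w v - x (act P w α) * S (w * refl P α) v -
      ∑ β ∈ coverRoots b (w * refl P α),
        P.pairingIn ℤ α β • S (w * refl P α * refl P β) v := by
  have h1 := hx.schubert_sub_right b hS hα h v
  have h2 := hx.root_mul_schubert b hS (w * refl P α) α v
  rw [act_mul P w, act_refl, act_negIdx, hx.apply_negIdx] at h2
  linear_combination h2 - h1

end IsRootForms

end LocalClasses

/-! ### Two realizations of the roots as prime linear forms -/

open MvPolynomial in
lemma sumSMulX_smul {σ k : Type*} [CommRing k] (z : k) (c : σ →₀ k) :
    sumSMulX (z • c) = C z * sumSMulX c := by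
  rw [map_smul, ← smul_eq_C_mul]

open MvPolynomial in
lemma isHomogeneous_sumSMulX {σ k : Type*} [CommRing k] (c : σ →₀ k) :
    (sumSMulX c).IsHomogeneous 1 := by
  rw [sumSMulX, Finsupp.linearCombination_apply]
  refine IsHomogeneous.sum _ _ _ fun i _ => ?_
  dsimp only
  rw [smul_eq_C_mul]
  exact isHomogeneous_C_mul_X _ _

section RootForms

variable {ι R M N : Type*} [CommRing R] [AddCommGroup M] [Module R M]
  [AddCommGroup N] [Module R N] {P : RootPairing ι R M N}
  [CharZero R] [P.IsCrystallographic]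

-- A linear form whose coefficients have no common nonunit divisor is irreducible, hence prime over
-- a factorial ring. A quotient of linear forms is a constant, so divisibility becomes
-- proportionality of coefficient vectors.
open MvPolynomial in
lemma isRootForms_sumSMulX {σ k : Type*} [CommRing k] [IsDomain k] [UniqueFactorizationMonoid k]
    {c : ι → σ →₀ k} (h1 : ∀ i r, (∀ j, r ∣ c i j) → IsUnit r)
    (h2 : ∀ i j (z : k), c j = z • c i → j = i ∨ j = negIdx P i)
    (h3 : ∀ β γ, c (P.reflectionPerm β γ) = c γ - P.pairingIn ℤ γ β • c β) :
    IsRootForms P (fun i => sumSMulX (c i)) := by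
  have hp (i : ι) : Prime (sumSMulX (c i)) := by
    rw [← UniqueFactorizationMonoid.irreducible_iff_prime]
    refine irreducible_sumSMulX _ ?_ (h1 i)
    rw [Finsupp.support_nonempty_iff]
    intro h
    exact not_isUnit_zero (h1 i 0 fun j => by simp [h])
  refine ⟨hp, fun i => isHomogeneous_sumSMulX _, fun i j ⟨q, hq⟩ => ?_, fun β γ => ?_⟩
  · have h4 : q.IsHomogeneous 0 := by
      apply isHomogeneous_of_mul (isHomogeneous_sumSMulX (c i)) (hp i).ne_zero
      rw [← hq]
      exact isHomogeneous_sumSMulX _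
    obtain ⟨z, rfl⟩ : ∃ z, q = C z :=
      ⟨_, totalDegree_eq_zero_iff_eq_C.1 ((totalDegree_zero_iff_isHomogeneous σ).2 h4)⟩
    apply h2 i j z
    rw [mul_comm, ← sumSMulX_smul] at hq
    ext l
    rw [← coeff_sumSMulX, hq, coeff_sumSMulX]
  · rw [h3, map_sub, map_zsmul]

lemma eq_or_eq_negIdx_of_smul_eq [IsDomain R] [P.IsReduced] {i j : ι} {d a : R} (hd : d ≠ 0)
    (h : d • P.root j = a • P.root i) : j = i ∨ j = negIdx P i := by
  by_contra! hne
  have hli := IsReduced.linearIndependent P hne.1 (by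
    rw [← root_negIdx]
    exact fun h' => hne.2 (P.root.injective h'))
  have := LinearIndependent.pair_iff.1 hli d (-a) (by rw [h, neg_smul, add_neg_cancel])
  exact hd this.1

variable [IsDomain R] [P.IsReduced] [Fintype ι]

/-- The integral coordinates of a root with respect to the simple roots. -/
def rootCoord (b : P.Base) (i : ι) : b.support →₀ ℤ :=
  b.toWeightBasisInt.repr (P.rootSpanMem ℤ i)

lemma rootCoord_reflectionPerm (b : P.Base) (β γ : ι) :
    rootCoord b (P.reflectionPerm β γ) =
      rootCoord b γ - P.pairingIn ℤ γ β • rootCoord b β := by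
  have h : P.rootSpanMem ℤ (P.reflectionPerm β γ) =
      P.rootSpanMem ℤ γ - P.pairingIn ℤ γ β • P.rootSpanMem ℤ β := by
    apply Subtype.ext
    change P.root _ = P.root γ - P.pairingIn ℤ γ β • P.root β
    rw [root_reflectionPerm, reflection_apply_root' ℤ]
  rw [rootCoord, h, map_sub, map_zsmul]
  rfl

lemma sum_rootCoord (b : P.Base) (i : ι) :
    ∑ j, rootCoord b i j • P.root j = P.root i := by
  have h := congrArg (Subtype.val) (b.toWeightBasisInt.sum_repr (P.rootSpanMem ℤ i))
  simpa [rootCoord] using h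

/-- A common divisor of the coordinates also divides all pairings of the root, so it survives
reflections. Reflections and negation lead to a simple root, which has a coordinate equal to 1. -/
lemma isUnit_of_forall_dvd_rootCoord (b : P.Base) (i : ι) (r : ℤ)
    (h : ∀ j, r ∣ rootCoord b i j) : IsUnit r := by
  have key {i β : ι} (h : ∀ j, r ∣ rootCoord b i j)
      (hβ : ∀ i, (∀ j, r ∣ rootCoord b i j) → r ∣ P.pairingIn ℤ i β) :
      ∀ j, r ∣ rootCoord b (P.reflectionPerm β i) j := by
    intro j
    rw [rootCoord_reflectionPerm, Finsupp.sub_apply, Finsupp.smul_apply, smul_eq_mul]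
    exact dvd_sub (h j) ((hβ i h).mul_right _)
  have hpair (i β : ι) (h : ∀ j, r ∣ rootCoord b i j) : r ∣ P.pairingIn ℤ i β := by
    have h1 : P.pairingIn ℤ i β = ∑ j, rootCoord b i j * P.pairingIn ℤ j β := by
      apply FaithfulSMul.algebraMap_injective ℤ R
      simp_rw [map_sum, map_mul, P.algebraMap_pairingIn, ← P.root_coroot'_eq_pairing]
      conv_lhs => rw [← sum_rootCoord b i, map_sum]
      simp
    rw [h1]
    exact Finset.dvd_sum fun j _ => (h j).mul_right _
  induction i using b.induction_reflect with
  | h₀ i hi => exact hi (by simpa using key h fun l hl => hpair l (P.reflectionPerm i i) hl)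
  | h₁ i hi =>
    have h1 := h ⟨i, hi⟩
    have h2 : rootCoord b i = Finsupp.single ⟨i, hi⟩ 1 := by
      rw [rootCoord, ← b.toWeightBasisInt.repr_self]
      congr 1
      exact Subtype.ext (by simp)
    rw [h2, Finsupp.single_eq_same] at h1
    exact isUnit_of_dvd_one h1
  | h₂ i j hi hj => exact hi (by simpa using key h fun l hl => hpair l j hl)

/-- The roots, as linear forms in the simple roots with integral coefficients. -/
def universalRoot (b : P.Base) (i : ι) : MvPolynomial b.support ℤ :=
  MvPolynomial.sumSMulX (rootCoord b i)

lemma isRootForms_universalRoot (b : P.Base) : IsRootForms P (universalRoot b) := by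
  refine isRootForms_sumSMulX (isUnit_of_forall_dvd_rootCoord b) (fun i j z h => ?_)
    (rootCoord_reflectionPerm b)
  apply eq_or_eq_negIdx_of_smul_eq (P := P) (d := 1) (a := (z : R)) one_ne_zero
  rw [one_smul, ← sum_rootCoord b j, h, Int.cast_smul_eq_zsmul, ← sum_rootCoord b i,
    Finset.smul_sum]
  simp [mul_smul]

section Field

variable {κ : Type*} (e : Module.Basis κ R M)

/-- The inclusion of the symmetric algebra of a free module into the polynomials over the
fraction field. -/
def toFieldPoly : SymmetricAlgebra R M →+* MvPolynomial κ (FractionRing R) :=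
  (MvPolynomial.map (algebraMap R (FractionRing R))).comp
    (SymmetricAlgebra.equivMvPolynomial e : SymmetricAlgebra R M →+* MvPolynomial κ R)

omit [CharZero R] in
lemma toFieldPoly_injective : Function.Injective (toFieldPoly e) :=
  (MvPolynomial.map_injective _ (IsFractionRing.injective R _)).comp
    (SymmetricAlgebra.equivMvPolynomial e).injective

omit [CharZero R] [IsDomain R] in
lemma equivMvPolynomial_ι (m : M) :
    SymmetricAlgebra.equivMvPolynomial e (SymmetricAlgebra.ι R M m) =
      MvPolynomial.sumSMulX (e.repr m) := by
  have h : (SymmetricAlgebra.equivMvPolynomial e).toLinearMap ∘ₗ SymmetricAlgebra.ι R M =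
      MvPolynomial.sumSMulX ∘ₗ e.repr.toLinearMap := by
    apply e.ext
    intro i
    simp [MvPolynomial.sumSMulX]
  exact LinearMap.congr_fun h m

lemma isHomogeneous_toFieldPoly {n : ℕ} {p : SymmetricAlgebra R M}
    (hp : p ∈ LinearMap.range (SymmetricAlgebra.ι R M) ^ n) :
    (toFieldPoly e p).IsHomogeneous n := by
  apply MvPolynomial.IsHomogeneous.map
  rw [← MvPolynomial.mem_homogeneousSubmodule, ← MvPolynomial.homogeneousSubmodule_one_pow]
  have h := Submodule.mem_map_of_mem
    (f := (SymmetricAlgebra.equivMvPolynomial e).toAlgHom.toLinearMap) hp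
  rw [Submodule.map_pow] at h
  have hle : Submodule.map (SymmetricAlgebra.equivMvPolynomial e).toAlgHom.toLinearMap
      (LinearMap.range (SymmetricAlgebra.ι R M)) ≤ MvPolynomial.homogeneousSubmodule κ R 1 := by
    rintro _ ⟨_, ⟨m, rfl⟩, rfl⟩
    change SymmetricAlgebra.equivMvPolynomial e _ ∈ _
    rw [equivMvPolynomial_ι]
    exact isHomogeneous_sumSMulX _
  exact pow_le_pow_left' hle n h

/-- Over a field every nonzero linear form is prime, so divisibility of a root in `M` does no harm.
Proportionality over the fraction field reduces to `M` by clearing denominators. -/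
lemma isRootForms_toFieldPoly : IsRootForms P (fun i => toFieldPoly e (wt P (P.root i))) := by
  have h0 (m : M) : toFieldPoly e (wt P m) = MvPolynomial.sumSMulX (Finsupp.mapRange.addMonoidHom
      (algebraMap R (FractionRing R)).toAddMonoidHom (e.repr m)) := by
    have h : toFieldPoly e (wt P m) = MvPolynomial.map (algebraMap R (FractionRing R))
        (SymmetricAlgebra.equivMvPolynomial e (SymmetricAlgebra.ι R M m)) := rfl
    rw [h, equivMvPolynomial_ι]
    simp only [MvPolynomial.sumSMulX, Finsupp.linearCombination_apply]
    rw [Finsupp.mapRange.addMonoidHom_apply, Finsupp.sum_mapRange_index (by simp), Finsupp.sum,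
      map_sum]
    refine Finset.sum_congr rfl fun j _ => ?_
    simp [Algebra.smul_def]
  simp only [h0]
  refine isRootForms_sumSMulX (fun i r h => ?_) (fun i j z h => ?_) (fun β γ => ?_)
  · rw [isUnit_iff_ne_zero]
    rintro rfl
    apply P.ne_zero i
    apply e.repr.injective
    ext l
    simpa using h l
  · obtain ⟨a, d, hd, rfl⟩ := IsFractionRing.div_surjective (A := R) z
    have hd0 := nonZeroDivisors.ne_zero hd
    refine eq_or_eq_negIdx_of_smul_eq (P := P) hd0 (a := a) ?_
    apply e.repr.injective
    ext l
    apply IsFractionRing.injective R (FractionRing R)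
    have h1 := DFunLike.congr_fun h l
    have h2 : algebraMap R (FractionRing R) d ≠ 0 := by simpa using hd0
    simp only [Finsupp.mapRange.addMonoidHom_apply, Finsupp.mapRange_apply, Finsupp.smul_apply,
      smul_eq_mul, RingHom.toAddMonoidHom_eq_coe, AddMonoidHom.coe_coe] at h1
    simp only [map_smul, Finsupp.smul_apply, smul_eq_mul, map_mul, h1]
    field_simp
  · rw [root_reflectionPerm, reflection_apply_root' ℤ, map_sub, map_sub, map_zsmul, map_zsmul]

end Field

section Specialize

variable (b : P.Base)

/-- The specialization of the universal coefficients. -/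
def specialize : MvPolynomial b.support ℤ →+* CoeffRing P :=
  (MvPolynomial.aeval fun j : b.support => wt P (P.root j)).toRingHom

lemma specialize_universalRoot (i : ι) :
    specialize b (universalRoot b i) = wt P (P.root i) := by
  rw [universalRoot, MvPolynomial.sumSMulX, Finsupp.linearCombination_apply,
    Finsupp.sum_fintype _ _ (by simp), map_sum, ← sum_rootCoord b i]
  unfold wt
  rw [map_sum]
  refine Finset.sum_congr rfl fun j _ => ?_
  simp [specialize]

lemma specialize_mem {n : ℕ} {p : MvPolynomial b.support ℤ} (hp : p.IsHomogeneous n) :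
    specialize b p ∈ homogeneousPart P n := by
  rw [← MvPolynomial.mem_homogeneousSubmodule, ← MvPolynomial.homogeneousSubmodule_one_pow] at hp
  rw [homogeneousPart]
  induction hp using Submodule.pow_induction_on_left' with
  | algebraMap r => exact ⟨r, by simp [specialize, Algebra.smul_def]⟩
  | add x y i hx hy h1 h2 => rw [map_add]; exact add_mem h1 h2
  | mem_mul m hm i x hx h =>
    rw [map_mul, pow_succ']
    refine Submodule.mul_mem_mul ?_ h
    rw [MvPolynomial.homogeneousSubmodule_one_eq_span_X] at hm
    induction hm using Submodule.span_induction with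
    | mem y hy =>
      obtain ⟨j, rfl⟩ := hy
      exact ⟨P.root j, by simp [specialize]⟩
    | zero => simp
    | add y z _ _ hy hz => rw [map_add]; exact add_mem hy hz
    | smul a y _ hy => rw [map_zsmul]; exact zsmul_mem hy a

end Specialize

end RootForms

/-! ### Transfer to the symmetric algebra of the weights -/

section Transport

variable {ι R M N : Type*} [Fintype ι] [CommRing R] [IsDomain R] [CharZero R]
  [AddCommGroup M] [Module R M] [AddCommGroup N] [Module R N]
  {P : RootPairing ι R M N} [P.IsCrystallographic] [P.IsReduced] (b : P.Base)

lemma IsSchubertClass.isLocalSchubert {κ : Type*} (e : Module.Basis κ R M) {w : P.weylGroup}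
    {p : ClassRing P} (hp : IsSchubertClass b w p) :
    IsLocalSchubert b (fun i => toFieldPoly e (wt P (P.root i))) w
      (fun v => toFieldPoly e (p.1 v)) where
  isGKM v β := by
    dsimp only
    rw [← map_sub]
    exact map_dvd _ (p.2 v β)
  isHomogeneous v := isHomogeneous_toFieldPoly e (hp.homogeneous v)
  vanishing v hv hne := by rw [hp.vanishing v hv hne, map_zero]
  value := by rw [hp.value, map_prod]

lemma isSchubertClass_unique [Module.Free R M] {w : P.weylGroup} {p q : ClassRing P}
    (hp : IsSchubertClass b w p) (hq : IsSchubertClass b w q) : p = q := by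
  have e := Module.Free.chooseBasis R M
  have h := (isRootForms_toFieldPoly e).isLocalSchubert_unique b (hp.isLocalSchubert b e)
    (hq.isLocalSchubert b e)
  apply Subtype.ext
  funext v
  exact toFieldPoly_injective e (congrFun h v)

/-- The specialization of a list of polynomials satisfying the divisibility conditions. -/
def specializeClass {p : P.weylGroup → MvPolynomial b.support ℤ}
    (hp : IsGKM (universalRoot b) p) : ClassRing P :=
  ⟨fun v => specialize b (p v), fun v β => by
    rw [← map_sub, ← specialize_universalRoot b]
    exact map_dvd _ (hp v β)⟩

lemma IsLocalSchubert.isSchubertClass {w : P.weylGroup}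
    {p : P.weylGroup → MvPolynomial b.support ℤ}
    (hp : IsLocalSchubert b (universalRoot b) w p) :
    IsSchubertClass b w (specializeClass b hp.isGKM) where
  homogeneous v := specialize_mem b (hp.isHomogeneous v)
  vanishing v hv hne := by
    change specialize b (p v) = 0
    rw [hp.vanishing v hv hne, map_zero]
  value := by
    change specialize b (p w) = _
    rw [hp.value, map_prod]
    simp only [specialize_universalRoot]

/-- The universal Schubert classes, with integral polynomials in the simple roots as values. -/
def universalSchubert (w v : P.weylGroup) : MvPolynomial b.support ℤ :=
  ((isRootForms_universalRoot b).exists_isLocalSchubert b w).choose v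

lemma isLocalSchubert_universalSchubert (w : P.weylGroup) :
    IsLocalSchubert b (universalRoot b) w (universalSchubert b w) :=
  ((isRootForms_universalRoot b).exists_isLocalSchubert b w).choose_spec

/-- Existence and uniqueness determine the chosen class, so identities between universal polynomials
pass to `schubertClass` through the ring homomorphism `specialize`. -/
lemma schubertClass_apply [Module.Free R M] (w v : P.weylGroup) :
    (schubertClass b w).1 v = specialize b (universalSchubert b w v) := by
  have h := (isLocalSchubert_universalSchubert b w).isSchubertClass b
  rw [schubertClass, isSchubertClass_unique b (Classical.epsilon_spec ⟨_, h⟩) h]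
  rfl

end Transport

end Schubert

end

theorem mainTheorem3 {ι R M N : Type*} [Fintype ι] [CommRing R] [IsDomain R] [CharZero R]
    [AddCommGroup M] [Module R M] [Module.Free R M] [Module.Finite R M]
    [AddCommGroup N] [Module R N]
    (P : RootPairing ι R M N) [P.IsCrystallographic] [P.IsReduced] (b : P.Base) :
    (∀ w : P.weylGroup, ∃! p : Schubert.ClassRing P, Schubert.IsSchubertClass b w p) ∧
    ∀ (w : P.weylGroup) (α : ι), α ∈ b.support →
      (Schubert.BruhatLT b w (w * Schubert.refl P α) →
        Schubert.rightAct P (Schubert.refl P α) (Schubert.schubertClass b w) =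
          Schubert.schubertClass b w) ∧
      (¬ Schubert.BruhatLT b w (w * Schubert.refl P α) →
        Schubert.rightAct P (Schubert.refl P α) (Schubert.schubertClass b w) =
          Schubert.schubertClass b w
          - Schubert.wt P (w • P.root α) • Schubert.schubertClass b (w * Schubert.refl P α)
          - ∑ β ∈ Schubert.coverRoots b (w * Schubert.refl P α),
              P.pairingIn ℤ α β •
                Schubert.schubertClass b (w * Schubert.refl P α * Schubert.refl P β)) := by
  refine ⟨fun w => ?_, fun w α hα => ⟨fun h => ?_, fun h => ?_⟩⟩
  · have h := (Schubert.isLocalSchubert_universalSchubert b w).isSchubertClass b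
    exact ⟨_, h, fun q hq => Schubert.isSchubertClass_unique b hq h⟩
  -- The Bruhat comparison of `w` and `w r_α` becomes the sign of `wα`.
  · rw [Schubert.bruhatLT_mul_refl_iff,
      Schubert.length_lt_mul_refl_iff b (RootPairing.Base.isPos_of_mem_support hα)] at h
    apply Subtype.ext
    funext v
    change (Schubert.schubertClass b w).1 (v * Schubert.refl P α) = _
    rw [Schubert.schubertClass_apply, Schubert.schubertClass_apply,
      (Schubert.isRootForms_universalRoot b).schubert_mul_refl_of_isPos b
        (Schubert.isLocalSchubert_universalSchubert b) hα h]
  · rw [Schubert.bruhatLT_mul_refl_iff,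
      Schubert.length_lt_mul_refl_iff b (RootPairing.Base.isPos_of_mem_support hα)] at h
    apply Subtype.ext
    funext v
    change (Schubert.schubertClass b w).1 (v * Schubert.refl P α) = _
    rw [Schubert.schubertClass_apply, (Schubert.isRootForms_universalRoot b).schubert_mul_refl b
      (Schubert.isLocalSchubert_universalSchubert b) hα h, map_sub, map_sub, map_mul, map_sum,
      Schubert.specialize_universalRoot, Schubert.root_act]
    simp only [AddSubgroupClass.coe_sub, Pi.sub_apply, AddSubmonoidClass.coe_finsetSum,
      Finset.sum_apply, map_zsmul, ← Schubert.schubertClass_apply]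
    rfl
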